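/- Let $K$ be a field, let $\mathscr X$ be a (small) poset regarded as a category, and let $\mathcal C:\mathscr X\to \mathrm{Coalg}_K$ be a functor to $K$-coalgebras which is right coflat: for every $\alpha:x\to y$ in $\mathscr X$, $\mathcal C_x$, regarded as a right $\mathcal C_y$-comodule via $\mathcal C_\alpha$, is coflat, i.e. the cotensor product functor $\mathcal C_x\,\square_{\mathcal C_y}-$ on left $\mathcal C_y$-comodules is exact. For a $K$-coalgebra $C$, a right $C$-contramodule is a $K$-space $M$ with a linear map $\pi_M:\mathrm{Hom}_K(C,M)\to M$ such that $\pi_M(c\mapsto\epsilon(c)m)=m$ for all $m\in M$, and $\pi_M(\pi_M\circ g)=\pi_M(\tilde g\circ\Delta)$ for all linear $g:C\to \mathrm{Hom}_K(C,M)$, where $\tilde g(a\otimes b)=g(a)(b)$; a morphism of contramodules is a linear map commuting with these structure maps. The dual $C^*=\mathrm{Hom}_K(C,K)$ is the free contramodule on $K$, with structure map $g\mapsto \tilde g\circ\Delta$. For a coalgebra map $\alpha:C\to D$, the contrarestriction $\alpha_\bullet$ sends $(M,\pi_M)$ to $M$ with structure map $f\mapsto\pi_M(f\circ\alpha)$,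 and the contraextension is $\alpha^\bullet M=\mathrm{Cohom}_D(C,M)$, the cokernel of the difference of the two maps $\mathrm{Hom}_K(C,\mathrm{Hom}_K(D,M))\rightrightarrows \mathrm{Hom}_K(C,M)$ given by $f\mapsto\tilde f\circ(\mathrm{id}\otimes\alpha)\circ\Delta_C$ and $f\mapsto\pi_M\circ f$, with the $C$-contramodule structure induced by that of $\mathrm{Hom}_K(C,M)$, the free $C$-contramodule on $M$; $\alpha^\bullet$ is left adjoint to $\alpha_\bullet$. A trans-contramodule $\mathcal M$ over $\mathcal C$ consists of a right $\mathcal C_x$-contramodule $\mathcal M_x$ for every $x\in\mathscr X$ and a morphism ${}_\alpha\mathcal M:\mathcal M_y\to\alpha_\bullet\mathcal M_x$ of $\mathcal C_y$-contramodules for every $\alpha:x\to y$, with ${}_{\mathrm{id}}\mathcal M=\mathrm{id}$ and ${}_{\beta\alpha}\mathcal M={}_\alpha\mathcal M\circ{}_\beta\mathcal M$ as maps $\mathcal M_z\to\mathcal M_x$ for $x\xrightarrow{\alpha}y\xrightarrow{\beta}z$; morphisms are families of contramodule morphisms commuting with these maps. It is cartesian if the adjoint morphism ${}^\alpha\mathcal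 M:\alpha^\bullet\mathcal M_y\to\mathcal M_x$ is an isomorphism for every $\alpha:x\to y$. Let $Cont^{tr}_c\text{-}\mathcal C$ be the category of cartesian trans-contramodules (a full subcategory of all trans-contramodules). Put $|\mathcal M|=\sum_{x}|\mathcal M_x|$. Then $Cont^{tr}_c\text{-}\mathcal C$ has a set of generators, i.e. there is a small set $\mathcal G$ of objects such that two parallel morphisms $f,g:\mathcal M\to\mathcal N$ with $fh=gh$ for all $G\in\mathcal G$ and all $h:G\to\mathcal M$ are equal. Moreover, let $\lambda$ be any regular cardinal such that, for every $x\in\mathscr X$, $\mathcal C_x^*$ is $\lambda$-presentable in the category of right $\mathcal C_x$-contramodules, and put $$\kappa=\sup\{\aleph_0,\ |K|,\ \lambda,\ |Mor(\mathscr X)|,\ (|K|^{|Mor(\mathscr X)|})^{|\mathcal C_x|}\ :\ x\in\mathscr X\},\qquad \mu=\sup\{\aleph_0,\ \dim_K\mathcal C_x\ :\ x\in\mathscr X\}.$$ Then for every cartesian trans-contramodule $\mathcal M$, every $x\in\mathscr X$ and every $m\in\mathcal M_x$, there is a cartesian trans-contramodule $\mathcal P\subseteq\mathcal M$ (a subobject,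 with each $\mathcal P_y\to\mathcal M_y$ injective) such that $m\in\mathcal P_x$ and $|\mathcal P|\le\kappa^\mu$. -/

import Mathlib

open CategoryTheory
open scoped TensorProduct

universe u

/-! ## Contramodules over a coalgebra -/

section Contramodules

/-- A right contramodule over a `K`-coalgebra `C`. The identification
`Hom(C, Hom(C, M)) = Hom(C ⊗ C, M)` sends `g` to `a ⊗ b ↦ g a b`
(adjunction of `- ⊗ C` with `Hom(C, -)`). -/
structure Contra (K : Type u) [Field K] (C : Type u) [AddCommGroup C] [Module K C]
    [Coalgebra K C] where
  carrier : Type u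
  [addCommGroup : AddCommGroup carrier]
  [module : Module K carrier]
  /-- the contraction map `π` -/
  contr : (C →ₗ[K] carrier) →ₗ[K] carrier
  contr_counit : ∀ m : carrier,
    contr ((Coalgebra.counit (R := K) (A := C)).smulRight m) = m
  contr_contr : ∀ g : C →ₗ[K] (C →ₗ[K] carrier),
    contr (contr ∘ₗ g) = contr (TensorProduct.lift g ∘ₗ Coalgebra.comul)

attribute [instance] Contra.addCommGroup Contra.module

variable {K : Type u} [Field K]
variable {C : Type u} [AddCommGroup C] [Module K C] [Coalgebra K C]
variable {D : Type u} [AddCommGroup D] [Module K D] [Coalgebra K D]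

instance : CoeSort (Contra K C) (Type u) := ⟨Contra.carrier⟩

namespace Contra

/-- Morphisms of contramodules: linear maps commuting with the contractions. -/
@[ext]
structure Hom (M N : Contra K C) where
  toLin : M →ₗ[K] N
  map_contr : ∀ f : C →ₗ[K] M, toLin (M.contr f) = N.contr (toLin ∘ₗ f)

instance : Category (Contra K C) where
  Hom := Hom
  id M := ⟨LinearMap.id, fun f => by simp⟩
  comp f g := ⟨g.toLin ∘ₗ f.toLin, fun h => by
    simp [f.map_contr, g.map_contr, LinearMap.comp_assoc]⟩

/-- The underlying linear map of a morphism of contramodules. -/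
abbrev lin {M N : Contra K C} (f : M ⟶ N) : M →ₗ[K] N := Hom.toLin f

/-- The free contramodule `T_C(V) = Hom_K(C, V)`. -/
def free (C : Type u) [AddCommGroup C] [Module K C] [Coalgebra K C]
    (V : Type u) [AddCommGroup V] [Module K V] : Contra K C where
  carrier := C →ₗ[K] V
  contr :=
    { toFun := fun g => TensorProduct.lift g ∘ₗ Coalgebra.comul
      map_add' := fun g h => by
        ext c
        simp only [LinearMap.comp_apply, LinearMap.add_apply]
        generalize (Coalgebra.comul c : C ⊗[K] C) = t
        induction t with
        | zero => simp
        | tmul a b => simp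
        | add a b ha hb => rw [map_add, ha, hb, map_add, map_add]; abel
      map_smul' := fun r g => by
        ext c
        simp only [LinearMap.comp_apply, LinearMap.smul_apply, RingHom.id_apply]
        generalize (Coalgebra.comul c : C ⊗[K] C) = t
        induction t with
        | zero => simp
        | tmul a b => simp
        | add a b ha hb => rw [map_add, ha, hb, map_add, smul_add] }
  contr_counit m := by
    ext c
    have h : TensorProduct.lift ((Coalgebra.counit (R := K) (A := C)).smulRight m) =
        m ∘ₗ (TensorProduct.lid K C).toLinearMap ∘ₗ
          (Coalgebra.counit (R := K) (A := C)).rTensor C := by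
      ext a b; simp
    have h2 := congrArg (TensorProduct.lid K C) (Coalgebra.rTensor_counit_comul (R := K) c)
    simp only [LinearMap.coe_mk, AddHom.coe_mk, h, LinearMap.comp_apply, LinearEquiv.coe_coe, h2]
    simp
  contr_contr g := by
    have h : ∀ t : (C ⊗[K] C), TensorProduct.lift
        ((show (C →ₗ[K] C →ₗ[K] V) →ₗ[K] (C →ₗ[K] V) from
          (LinearMap.lcomp K V (Coalgebra.comul (R := K) (A := C))) ∘ₗ
            (TensorProduct.uncurry (RingHom.id K) C C V)) ∘ₗ g) t =
        TensorProduct.lift (TensorProduct.lift g)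
          ((TensorProduct.assoc K C C C).symm
            ((Coalgebra.comul (R := K) (A := C)).lTensor C t)) := by
      intro t
      induction t with
      | zero => simp
      | add a b ha hb => simp only [map_add, ha, hb]
      | tmul a b =>
        simp only [TensorProduct.lift.tmul, LinearMap.comp_apply, LinearMap.lTensor_tmul]
        change TensorProduct.lift (g a) (Coalgebra.comul b) = _
        generalize (Coalgebra.comul b : C ⊗[K] C) = s
        induction s with
        | zero => simp
        | add x y hx hy => simp only [map_add, hx, hy, TensorProduct.tmul_add]
        | tmul x y => simp
    ext c
    change _ = TensorProduct.lift (TensorProduct.lift g ∘ₗ Coalgebra.comul) (Coalgebra.comul c)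
    refine (h (Coalgebra.comul c)).trans ?_
    rw [← Coalgebra.coassoc_apply (R := K) c, LinearEquiv.symm_apply_apply]
    generalize (Coalgebra.comul c : C ⊗[K] C) = t
    induction t with
    | zero => simp
    | tmul a b => simp
    | add a b ha hb => simp only [map_add, ha, hb]

theorem free_contr (V : Type u) [AddCommGroup V] [Module K V]
    (g : C →ₗ[K] (C →ₗ[K] V)) :
    (free C V).contr g = TensorProduct.lift g ∘ₗ Coalgebra.comul := rfl

/-- The dual `C^* = Hom_K(C, K)` as a contramodule. -/
abbrev dual (K : Type u) [Field K] (C : Type u) [AddCommGroup C] [Module K C]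
    [Coalgebra K C] : Contra K C := free C K

theorem exists_section (M : Type u) [AddCommGroup M] [Module K M] (R : Submodule K M) :
    ∃ s : (M ⧸ R) →ₗ[K] M, R.mkQ ∘ₗ s = LinearMap.id :=
  LinearMap.exists_rightInverse_of_surjective _ R.range_mkQ

/-- The contraction on a quotient: lift a map `C → M ⧸ R` to `C → M`, contract, project.
The result does not depend on the lift, see `quotContr_mk`. -/
noncomputable def quotContr (M : Contra K C) (R : Submodule K M) :
    (C →ₗ[K] (M ⧸ R)) →ₗ[K] (M ⧸ R) :=
  R.mkQ ∘ₗ M.contr ∘ₗ LinearMap.llcomp K C (M ⧸ R) M (exists_section M R).choose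

theorem quotContr_mk (M : Contra K C) (R : Submodule K M)
    (hR : ∀ g : C →ₗ[K] M, (∀ c, g c ∈ R) → M.contr g ∈ R) (h : C →ₗ[K] M) :
    quotContr M R (R.mkQ ∘ₗ h) = R.mkQ (M.contr h) := by
  have hs := (exists_section M R).choose_spec
  set s := (exists_section M R).choose with hsdef
  change R.mkQ (M.contr (s ∘ₗ (R.mkQ ∘ₗ h))) = R.mkQ (M.contr h)
  rw [← sub_eq_zero, ← map_sub, ← map_sub, Submodule.mkQ_apply, Submodule.Quotient.mk_eq_zero]
  apply hR
  intro c
  rw [← Submodule.Quotient.mk_eq_zero, ← Submodule.mkQ_apply]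
  have := LinearMap.congr_fun hs (R.mkQ (h c))
  simp only [LinearMap.comp_apply, LinearMap.id_apply] at this
  simp only [LinearMap.sub_apply, LinearMap.comp_apply, map_sub, this, sub_self]

theorem exists_lift {V W : Type u} [AddCommGroup V] [Module K V] [AddCommGroup W] [Module K W]
    (R : Submodule K W) (g : V →ₗ[K] (W ⧸ R)) : ∃ h : V →ₗ[K] W, R.mkQ ∘ₗ h = g := by
  obtain ⟨s, hs⟩ := exists_section W R
  exact ⟨s ∘ₗ g, by rw [← LinearMap.comp_assoc, hs, LinearMap.id_comp]⟩

/-- The quotient of a contramodule by a subcontramodule `R`. -/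
noncomputable def quotient (M : Contra K C) (R : Submodule K M)
    (hR : ∀ g : C →ₗ[K] M, (∀ c, g c ∈ R) → M.contr g ∈ R) : Contra K C where
  carrier := M ⧸ R
  contr := quotContr M R
  contr_counit q := by
    obtain ⟨m, rfl⟩ := R.mkQ_surjective q
    have : (Coalgebra.counit (R := K) (A := C)).smulRight (R.mkQ m) =
        R.mkQ ∘ₗ (Coalgebra.counit (R := K) (A := C)).smulRight m := by ext; simp
    rw [this, quotContr_mk M R hR, M.contr_counit]
  contr_contr g := by
    obtain ⟨s, hs⟩ := exists_section M R
    let h : C →ₗ[K] (C →ₗ[K] M) := LinearMap.llcomp K C (M ⧸ R) M s ∘ₗ g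
    have hg : ∀ c, g c = R.mkQ ∘ₗ h c := fun c => by
      change g c = R.mkQ ∘ₗ (s ∘ₗ g c)
      rw [← LinearMap.comp_assoc, hs, LinearMap.id_comp]
    have h1 : quotContr M R ∘ₗ g = R.mkQ ∘ₗ (M.contr ∘ₗ h) := by
      ext c
      simp only [LinearMap.comp_apply]
      rw [hg c, quotContr_mk M R hR]
    have h2 : TensorProduct.lift g = R.mkQ ∘ₗ TensorProduct.lift h := by
      ext a b
      simp [hg a]
    rw [h1, h2, quotContr_mk M R hR, M.contr_contr, LinearMap.comp_assoc, quotContr_mk M R hR]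

/-- Contrarestriction `α_•` along a coalgebra morphism `α : C → D`. -/
def restr (α : C →ₗc[K] D) (M : Contra K C) : Contra K D where
  carrier := M
  contr := M.contr ∘ₗ LinearMap.lcomp K M α.toLinearMap
  contr_counit m := by
    have : ((Coalgebra.counit (R := K) (A := D)).smulRight m) ∘ₗ α.toLinearMap =
        (Coalgebra.counit (R := K) (A := C)).smulRight m := by
      rw [← α.counit_comp]; ext; simp
    change M.contr (((Coalgebra.counit (R := K) (A := D)).smulRight m) ∘ₗ α.toLinearMap) = m
    rw [this, M.contr_counit]
  contr_contr g := by
    let h : C →ₗ[K] (C →ₗ[K] M) := LinearMap.lcomp K M α.toLinearMap ∘ₗ g ∘ₗ α.toLinearMap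
    have h2 : TensorProduct.lift h =
        TensorProduct.lift g ∘ₗ TensorProduct.map α.toLinearMap α.toLinearMap := by
      ext a b; rfl
    change M.contr (M.contr ∘ₗ h) =
      M.contr ((TensorProduct.lift g ∘ₗ Coalgebra.comul) ∘ₗ α.toLinearMap)
    rw [M.contr_contr, h2, LinearMap.comp_assoc, LinearMap.comp_assoc, α.map_comp_comul]

/-- The right `D`-coaction `(id ⊗ α) ∘ Δ` on `C` induced by `α : C → D`. -/
noncomputable def rightCoact (α : C →ₗc[K] D) : C →ₗ[K] C ⊗[K] D :=
  α.toLinearMap.lTensor C ∘ₗ Coalgebra.comul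

/-- The difference of the two maps
`Hom(C, Hom(D, M)) = Hom(C ⊗ D, M) ⇉ Hom(C, M)`, given by `f ↦ f ∘ ρ` (with `ρ` the right
`D`-coaction on `C`) and `f ↦ π_M ∘ f`, whose cokernel is `Cohom_D(C, M)`. -/
noncomputable def cohomRel (α : C →ₗc[K] D) (M : Contra K D) :
    (C →ₗ[K] (D →ₗ[K] M)) →ₗ[K] (C →ₗ[K] M) :=
  LinearMap.lcomp K M (rightCoact α) ∘ₗ
      (TensorProduct.uncurry (RingHom.id K) C D M)
    - LinearMap.llcomp K C (D →ₗ[K] M) M M.contr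

theorem cohomRel_apply (α : C →ₗc[K] D) (M : Contra K D) (f : C →ₗ[K] (D →ₗ[K] M)) :
    cohomRel α M f = TensorProduct.lift f ∘ₗ rightCoact α - M.contr ∘ₗ f := rfl

theorem cohomRel_closed (α : C →ₗc[K] D) (M : Contra K D) (g : C →ₗ[K] (C →ₗ[K] M))
    (hg : ∀ c, g c ∈ LinearMap.range (cohomRel α M)) :
    (free C M).contr g ∈ LinearMap.range (cohomRel α M) := by
  obtain ⟨h, hh⟩ : ∃ h : C →ₗ[K] (C →ₗ[K] (D →ₗ[K] M)), cohomRel α M ∘ₗ h = g := by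
    obtain ⟨s, hs⟩ := LinearMap.exists_rightInverse_of_surjective
      (cohomRel α M).rangeRestrict (LinearMap.range_rangeRestrict _)
    refine ⟨s ∘ₗ g.codRestrict _ hg, ?_⟩
    ext1 c
    have := congrArg Subtype.val (LinearMap.congr_fun hs (g.codRestrict _ hg c))
    exact this
  refine ⟨TensorProduct.lift h ∘ₗ Coalgebra.comul, ?_⟩
  rw [free_contr, cohomRel_apply]
  ext c
  have key : ∀ t : C ⊗[K] C, TensorProduct.lift g t =
      TensorProduct.lift (TensorProduct.lift h) (α.toLinearMap.lTensor (C ⊗[K] C)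
        ((TensorProduct.assoc K C C C).symm ((Coalgebra.comul (R := K) (A := C)).lTensor C t)))
      - M.contr (TensorProduct.lift h t) := by
    intro t
    induction t with
    | zero => simp
    | add a b ha hb => simp only [map_add, ha, hb]; abel
    | tmul a b =>
      rw [← hh]
      simp only [TensorProduct.lift.tmul, LinearMap.comp_apply, LinearMap.lTensor_tmul,
        cohomRel_apply, LinearMap.sub_apply, rightCoact]
      congr 1
      generalize (Coalgebra.comul b : C ⊗[K] C) = s
      induction s with
      | zero => simp
      | add x y hx hy => simp only [map_add, hx, hy, TensorProduct.tmul_add]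
      | tmul x y => simp
  rw [LinearMap.comp_apply (TensorProduct.lift g), key, ← Coalgebra.coassoc_apply (R := K) c,
    LinearEquiv.symm_apply_apply]
  simp only [LinearMap.sub_apply, LinearMap.comp_apply, rightCoact]
  congr 1
  generalize (Coalgebra.comul c : C ⊗[K] C) = t
  induction t with
  | zero => simp
  | tmul a b => simp
  | add a b ha hb => simp only [map_add, ha, hb]

/-- Contraextension `α^• M = Cohom_D(C, M)`, as a contramodule over `C`: the quotient of
`Hom_K(C, M) = T_C(M)` by the image of the difference of the two structure maps. -/
noncomputable def contraext (α : C →ₗc[K] D) (M : Contra K D) : Contra K C :=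
  quotient (free C M) (LinearMap.range (cohomRel α M)) (cohomRel_closed α M)

/-- The morphism `α^• M → N` adjoint to `φ : M → α_• N`; it sends the class of
`f : C → M` to `π_N (φ ∘ f)`. -/
noncomputable def extDesc (α : C →ₗc[K] D) {M : Contra K D} {N : Contra K C}
    (φ : M ⟶ restr α N) : contraext α M ⟶ N :=
  let φ' : M →ₗ[K] N := lin φ
  let p : (C →ₗ[K] M) →ₗ[K] N := N.contr ∘ₗ LinearMap.llcomp K C M N φ'
  have hp : LinearMap.range (cohomRel α M) ≤ LinearMap.ker p := by
    rintro _ ⟨f, rfl⟩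
    rw [LinearMap.mem_ker, cohomRel_apply, map_sub, sub_eq_zero]
    let h : C →ₗ[K] (C →ₗ[K] N) :=
      LinearMap.lcomp K N α.toLinearMap ∘ₗ LinearMap.llcomp K D M N φ' ∘ₗ f
    have h1 : φ' ∘ₗ (M.contr ∘ₗ f) = N.contr ∘ₗ h := by
      ext c
      exact Hom.map_contr φ (f c)
    have h2 : φ' ∘ₗ (TensorProduct.lift f ∘ₗ rightCoact α) =
        TensorProduct.lift h ∘ₗ Coalgebra.comul := by
      have : φ' ∘ₗ (TensorProduct.lift f ∘ₗ α.toLinearMap.lTensor C) = TensorProduct.lift h := by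
        ext a b; rfl
      rw [← this]; rfl
    change N.contr (φ' ∘ₗ (TensorProduct.lift f ∘ₗ rightCoact α)) =
      N.contr (φ' ∘ₗ (M.contr ∘ₗ f))
    rw [h1, h2, N.contr_contr]
  { toLin := Submodule.liftQ _ p hp
    map_contr := fun g => by
      change C →ₗ[K] ((C →ₗ[K] M) ⧸ LinearMap.range (cohomRel α M)) at g
      obtain ⟨h, rfl⟩ := exists_lift (LinearMap.range (cohomRel α M)) g
      have e := quotContr_mk (free C M) (LinearMap.range (cohomRel α M)) (cohomRel_closed α M) h
      refine (congrArg (Submodule.liftQ (LinearMap.range (cohomRel α M)) p hp) e).trans ?_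
      let k : C →ₗ[K] (C →ₗ[K] N) := LinearMap.llcomp K C M N φ' ∘ₗ h
      have h2 : φ' ∘ₗ TensorProduct.lift h = TensorProduct.lift k := by
        ext a b; rfl
      change N.contr (φ' ∘ₗ (TensorProduct.lift h ∘ₗ Coalgebra.comul)) = N.contr (N.contr ∘ₗ k)
      rw [N.contr_contr, ← LinearMap.comp_assoc, h2] }

end Contra

/-! ## Coflat morphisms of coalgebras -/

/-- A left comodule over a `K`-coalgebra `D`. -/
structure LeftComod (K : Type u) [Field K] (D : Type u) [AddCommGroup D] [Module K D]
    [Coalgebra K D] where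
  carrier : Type u
  [addCommGroup : AddCommGroup carrier]
  [module : Module K carrier]
  coact : carrier →ₗ[K] D ⊗[K] carrier
  coassoc : (TensorProduct.assoc K D D carrier).toLinearMap ∘ₗ
      (Coalgebra.comul (R := K) (A := D)).rTensor carrier ∘ₗ coact = coact.lTensor D ∘ₗ coact
  counit : (TensorProduct.lid K carrier).toLinearMap ∘ₗ
      (Coalgebra.counit (R := K) (A := D)).rTensor carrier ∘ₗ coact = LinearMap.id

attribute [instance] LeftComod.addCommGroup LeftComod.module

instance : CoeSort (LeftComod K D) (Type u) := ⟨LeftComod.carrier⟩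

namespace LeftComod

/-- Morphisms of left comodules. -/
structure Hom (N P : LeftComod K D) where
  toLin : N →ₗ[K] P
  comm : P.coact ∘ₗ toLin = toLin.lTensor D ∘ₗ N.coact

/-- The cotensor product `C □_D N`, for `C` a right `D`-comodule via `α : C → D`. -/
noncomputable def cotensor (α : C →ₗc[K] D) (N : LeftComod K D) : Submodule K (C ⊗[K] N) :=
  LinearMap.eqLocus
    ((TensorProduct.assoc K C D N).toLinearMap ∘ₗ (Contra.rightCoact α).rTensor N)
    (N.coact.lTensor C)

theorem cotensor_map (α : C →ₗc[K] D) {N P : LeftComod K D} (f : Hom N P) :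
    ∀ t ∈ cotensor α N, f.toLin.lTensor C t ∈ cotensor α P := by
  intro t ht
  have ht' : (TensorProduct.assoc K C D N) ((Contra.rightCoact α).rTensor N t) =
      N.coact.lTensor C t := ht
  change (TensorProduct.assoc K C D P) ((Contra.rightCoact α).rTensor P (f.toLin.lTensor C t)) =
      P.coact.lTensor C (f.toLin.lTensor C t)
  rw [← LinearMap.lTensor_comp_apply, f.comm, LinearMap.lTensor_comp_apply, ← ht']
  clear ht ht'
  induction t with
  | zero => simp
  | add a b ha hb => simp only [map_add, ha, hb]
  | tmul c n =>
    simp only [LinearMap.lTensor_tmul, LinearMap.rTensor_tmul]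
    generalize Contra.rightCoact α c = s
    induction s with
    | zero => simp
    | add x y hx hy => simp only [map_add, hx, hy, TensorProduct.add_tmul]
    | tmul x y => simp

/-- The map `C □_D f : C □_D N → C □_D P`. -/
noncomputable def cotensorMap (α : C →ₗc[K] D) {N P : LeftComod K D} (f : Hom N P) :
    cotensor α N →ₗ[K] cotensor α P :=
  (f.toLin.lTensor C).restrict (cotensor_map α f)

end LeftComod

/-- `α : C → D` is right coflat: `C` is coflat as a right `D`-comodule, i.e. the functor
`C □_D -` on left `D`-comodules preserves exact sequences. -/
def RightCoflat (α : C →ₗc[K] D) : Prop :=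
  ∀ (N P Q : LeftComod K D) (f : LeftComod.Hom N P) (g : LeftComod.Hom P Q),
    Function.Exact f.toLin g.toLin →
    Function.Exact (LeftComod.cotensorMap α f) (LeftComod.cotensorMap α g)

end Contramodules

/-! ## Trans-contramodules over a coalgebra representation -/

section Representations

variable {K : Type u} [Field K] {X : Type u} [SmallCategory X]

/-- A right trans-contramodule over a coalgebra representation `F : X ⥤ Coalg`. -/
structure TransContra (F : X ⥤ CoalgCat.{u} K) where
  obj : ∀ x : X, Contra K (F.obj x)
  /-- the structure morphism `M_y → α_• M_x` for `α : x → y` -/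
  map : ∀ {x y : X} (α : x ⟶ y), obj y ⟶ Contra.restr (F.map α).toCoalgHom (obj x)
  map_id : ∀ (x : X) (m : obj x), Contra.lin (map (𝟙 x)) m = m
  map_comp : ∀ {x y z : X} (α : x ⟶ y) (β : y ⟶ z) (m : obj z),
    Contra.lin (map (α ≫ β)) m = Contra.lin (map α) (Contra.lin (map β) m)

namespace TransContra

variable {F : X ⥤ CoalgCat.{u} K}

/-- Morphisms of trans-contramodules. -/
@[ext]
structure Hom (M N : TransContra F) where
  app : ∀ x : X, M.obj x ⟶ N.obj x
  naturality : ∀ {x y : X} (α : x ⟶ y) (m : M.obj y),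
    Contra.lin (N.map α) (Contra.lin (app y) m) = Contra.lin (app x) (Contra.lin (M.map α) m)

instance : Category (TransContra F) where
  Hom := Hom
  id M := ⟨fun x => 𝟙 (M.obj x), fun _ _ => rfl⟩
  comp f g := ⟨fun x => f.app x ≫ g.app x, fun {_ y} α m =>
    (g.naturality α (Contra.lin (f.app y) m)).trans
      (congrArg _ (f.naturality α m))⟩

/-- `M` is cartesian if `α^• M_y → M_x` is an isomorphism of contramodules for all
`α : x → y`. -/
def IsCartesian (M : TransContra F) : Prop :=
  ∀ {x y : X} (α : x ⟶ y), IsIso (Contra.extDesc (F.map α).toCoalgHom (M.map α))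

/-- The cardinality of `M`, i.e. of the disjoint union of the sets `M_x`. -/
def card (M : TransContra F) : Cardinal.{u} := Cardinal.mk (Σ x : X, M.obj x)

end TransContra

/-- The full subcategory of cartesian trans-contramodules. -/
abbrev CartTransContra (F : X ⥤ CoalgCat.{u} K) : Type (u + 1) :=
  ObjectProperty.FullSubcategory (fun M : TransContra F => M.IsCartesian)

/-- A right coflat representation. -/
def RightCoflatRep (F : X ⥤ CoalgCat.{u} K) : Prop :=
  ∀ {x y : X} (α : x ⟶ y), RightCoflat (F.map α).toCoalgHom

/-- The cardinality of the set of all morphisms of `X`. -/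
def cardMor (X : Type u) [SmallCategory X] : Cardinal.{u} :=
  Cardinal.mk (Σ p : X × X, (p.1 ⟶ p.2))

/-- `κ = sup {ℵ₀, |K|, lam, |Mor X|, (|K| ^ |Mor X|) ^ |C_x| : x ∈ X}`. -/
noncomputable def kappa (F : X ⥤ CoalgCat.{u} K) (lam : Cardinal.{u}) : Cardinal.{u} :=
  max (max (max Cardinal.aleph0 (Cardinal.mk K)) (max lam (cardMor X)))
    (⨆ x : X, (Cardinal.mk K ^ cardMor X) ^ Cardinal.mk (F.obj x))

/-- `μ = sup {ℵ₀, dim C_x : x ∈ X}`. -/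
noncomputable def mu (F : X ⥤ CoalgCat.{u} K) : Cardinal.{u} :=
  max Cardinal.aleph0 (⨆ x : X, Module.rank K (F.obj x))

end Representations

/-!
Löwenheim–Skolem for cartesian trans-contramodules. Cartesianness of `M` means that for each
`α : x ⟶ y` the sequence
`Hom(C_x ⊗ C_y, M_y) → Hom(C_x, M_y) → M_x → 0` is exact, and a family of subspaces inherits this
as soon as it is closed under the second map and under chosen preimages for both maps. These are
operations of arity at most `μ`, one for each choice of `α` and of a basis vector of `K`, `C_x` or
`C_x ⊗ C_y`, so the closure of a single element has cardinality at most `(max |K| |Mor X|) ^ μ`. Up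
to isomorphism there is only a set of trans-contramodules of bounded cardinality, and those among
them that are cartesian generate.
-/

section Closure

open Cardinal

theorem sum_le_of_forall_le {ι : Type u} {f : ι → Cardinal.{u}} {c : Cardinal.{u}} (hc : ℵ₀ ≤ c)
    (hι : #ι ≤ c) (hf : ∀ i, f i ≤ c) : sum f ≤ c :=
  calc sum f ≤ sum fun _ : ι => c := sum_le_sum _ _ hf
    _ = #ι * c := sum_const' ι c
    _ ≤ c := mul_le_of_le hc hι le_rfl

theorem exists_closed_set {S A : Type u} {β : A → Type u} (op : ∀ a, (β a → S) → S)
    {κ μ : Cardinal.{u}} (hκ : 1 < κ) (hμ : ℵ₀ ≤ μ) (hA : #A ≤ κ ^ μ) (hβ : ∀ a, #(β a) ≤ μ) :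
    ∃ T : Set S, #T ≤ κ ^ μ ∧ ∀ a (f : β a → S), (∀ b, f b ∈ T) → op a f ∈ T := by
  let value : WType β → S := WType.elim S fun s => op s.1 s.2
  refine ⟨Set.range value, mk_range_le.trans (WType.cardinalMk_le_of_le ?_), fun a f hf => ?_⟩
  · have infinite : ℵ₀ ≤ κ ^ μ := hμ.trans (cantor' μ hκ).le
    refine sum_le_of_forall_le infinite hA fun a => ?_
    calc (κ ^ μ) ^ #(β a) ≤ (κ ^ μ) ^ μ :=
          power_le_power_left (aleph0_pos.trans_le infinite).ne' (hβ a)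
      _ = κ ^ μ := by rw [← power_mul, mul_eq_self hμ]
  · choose t ht using hf
    exact ⟨WType.mk a t, congrArg (op a) (funext ht)⟩

/-- An operation on a many-sorted set `M`, with all arguments taken from one sort. -/
structure SortedOperation {X : Type u} (M : X → Type u) where
  Arity : Type u
  src : X
  tgt : X
  eval : (Arity → M src) → M tgt

namespace SortedOperation

variable {X : Type u} {M : X → Type u}

/-- Closure of a family of subsets under a many-sorted operation. -/
def Preserves (o : SortedOperation M) (T : ∀ x, Set (M x)) : Prop :=
  ∀ f : o.Arity → M o.src, (∀ b, f b ∈ T o.src) → o.eval f ∈ T o.tgt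

theorem exists_preserved_sets [∀ x, Nonempty (M x)] {A : Type u} (o : A → SortedOperation M)
    {κ μ : Cardinal.{u}} (hκ : 1 < κ) (hμ : ℵ₀ ≤ μ) (hA : #A ≤ κ ^ μ)
    (hArity : ∀ a, #(o a).Arity ≤ μ) :
    ∃ T : ∀ x, Set (M x), #(Σ x, T x) ≤ κ ^ μ ∧ ∀ a, (o a).Preserves T := by
  let op (a : A) (f : (o a).Arity → Σ x, M x) : Σ x, M x :=
    ⟨(o a).tgt, (o a).eval fun b => Function.invFun (Sigma.mk (o a).src) (f b)⟩
  obtain ⟨T, card_T, closed⟩ := exists_closed_set op hκ hμ hA hArity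
  refine ⟨fun x => Sigma.mk x ⁻¹' T, le_trans ?_ card_T, fun a f hf => ?_⟩
  · refine mk_le_of_injective (f := fun t => (⟨⟨t.1, t.2⟩, t.2.2⟩ : T)) ?_
    rintro ⟨x, m, hm⟩ ⟨y, n, hn⟩ h
    cases congrArg Subtype.val h
    rfl
  · have invFun_mk (m : M (o a).src) : Function.invFun (Sigma.mk (o a).src) ⟨_, m⟩ = m :=
      Function.leftInverse_invFun sigma_mk_injective m
    simpa only [op, invFun_mk, Set.mem_preimage] using closed a (fun b => ⟨_, f b⟩) hf

end SortedOperation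

theorem forall_mem_of_basis {K V W ι : Type*} [Semiring K] [AddCommMonoid V] [Module K V]
    [AddCommMonoid W] [Module K W] (b : Module.Basis ι K V) {f : V →ₗ[K] W} {S : Submodule K W}
    (h : ∀ i, f (b i) ∈ S) (v : V) : f v ∈ S := by
  have top_le : ⊤ ≤ S.comap f := by
    rw [← b.span_eq, Submodule.span_le]
    rintro _ ⟨i, rfl⟩
    exact h i
  exact top_le Submodule.mem_top

section Submodules

variable {K : Type*} [Semiring K] {X : Type u} {M : X → Type u} [∀ x, AddCommMonoid (M x)]
  [∀ x, Module K (M x)]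

/-- The operation `(m, n) ↦ r m + t n` on the component `M x`. -/
def SortedOperation.linearCombination (x : X) (r t : K) : SortedOperation M where
  Arity := ULift Bool
  src := x
  tgt := x
  eval f := r • f ⟨false⟩ + t • f ⟨true⟩

theorem exists_submodule_eq_of_preserves {T : ∀ x, Set (M x)} (nonempty : ∀ x, (T x).Nonempty)
    (hT : ∀ x (r t : K), (SortedOperation.linearCombination x r t).Preserves T) :
    ∃ S : ∀ x, Submodule K (M x), (fun x => (S x : Set (M x))) = T := by
  have linearCombination_mem {x : X} (r t : K) {m n : M x} (hm : m ∈ T x) (hn : n ∈ T x) :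
      r • m + t • n ∈ T x :=
    hT x r t (fun b => bif b.down then n else m) (by rintro ⟨_ | _⟩ <;> assumption)
  refine ⟨fun x =>
    { carrier := T x
      add_mem' := fun hm hn => ?_
      zero_mem' := ?_
      smul_mem' := fun r m hm => ?_ }, rfl⟩
  · simpa only [one_smul] using linearCombination_mem 1 1 hm hn
  · obtain ⟨m, hm⟩ := nonempty x
    simpa only [zero_smul, add_zero] using linearCombination_mem 0 0 hm hm
  · simpa only [zero_smul, add_zero] using linearCombination_mem r 0 hm hm

end Submodules

/-- An operation on a many-sorted vector space `M` which turns a linear map `dom → M src` into a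
linear map `cod → M tgt`. -/
structure LinearOperation (K : Type u) [Field K] {X : Type u} (M : X → Type u)
    [∀ x, AddCommGroup (M x)] [∀ x, Module K (M x)] where
  dom : ModuleCat.{u} K
  cod : ModuleCat.{u} K
  src : X
  tgt : X
  eval : (dom →ₗ[K] M src) → (cod →ₗ[K] M tgt)

variable {K : Type u} [Field K] {X : Type u} {M : X → Type u} [∀ x, AddCommGroup (M x)]
  [∀ x, Module K (M x)]

namespace LinearOperation

/-- Closure of a family of subspaces under a linear operation. -/
def Preserves (o : LinearOperation K M) (S : ∀ x, Submodule K (M x)) : Prop :=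
  ∀ f : o.dom →ₗ[K] M o.src, (∀ v, f v ∈ S o.src) → ∀ w, o.eval f w ∈ S o.tgt

/-- The coordinate of a linear operation at `w : cod`, as an operation on the families of values of
linear maps on a basis of `dom`. -/
noncomputable def coordinate (o : LinearOperation K M) (w : o.cod) : SortedOperation M where
  Arity := Module.Basis.ofVectorSpaceIndex K o.dom
  src := o.src
  tgt := o.tgt
  eval g := o.eval ((Module.Basis.ofVectorSpace K o.dom).constr K g) w

theorem preserves_of_coordinate {o : LinearOperation K M} {S : ∀ x, Submodule K (M x)}
    (h : ∀ i, (o.coordinate (Module.Basis.ofVectorSpace K o.cod i)).Preserves fun x => S x) :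
    o.Preserves S := fun f hf =>
  forall_mem_of_basis (Module.Basis.ofVectorSpace K o.cod) fun i =>
    (Module.Basis.ofVectorSpace K o.dom).constr_self K f ▸
      h i (fun j => f (Module.Basis.ofVectorSpace K o.dom j)) fun _ => hf _

end LinearOperation

theorem LinearOperation.exists_preserved_submodules {A : Type u} (o : A → LinearOperation K M)
    (seed : ∀ x, M x) {κ μ : Cardinal.{u}} (hκ : 1 < κ) (hμ : ℵ₀ ≤ μ)
    (hK : #K ≤ κ ^ μ) (hX : #X ≤ κ ^ μ) (hA : #A ≤ κ ^ μ)
    (hdom : ∀ a, Module.rank K (o a).dom ≤ μ) (hcod : ∀ a, Module.rank K (o a).cod ≤ κ ^ μ) :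
    ∃ S : ∀ x, Submodule K (M x), (∀ x, seed x ∈ S x) ∧ (∀ a, (o a).Preserves S) ∧
      #(Σ x, S x) ≤ κ ^ μ := by
  let basis (a : A) := Module.Basis.ofVectorSpace K (o a).cod
  let const (x : X) : SortedOperation M := ⟨PEmpty, x, x, fun _ => seed x⟩
  let ops : X ⊕ (X × K × K) ⊕ (Σ a, Module.Basis.ofVectorSpaceIndex K (o a).cod) →
      SortedOperation M :=
    Sum.elim const (Sum.elim (fun p => .linearCombination p.1 p.2.1 p.2.2)
      fun p => (o p.1).coordinate (basis p.1 p.2))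
  have infinite : ℵ₀ ≤ κ ^ μ := hμ.trans (cantor' μ hκ).le
  have card_ops : #(X ⊕ (X × K × K) ⊕ (Σ a, Module.Basis.ofVectorSpaceIndex K (o a).cod)) ≤
      κ ^ μ := by
    have card_coordinates := mk_sigma (fun a => Module.Basis.ofVectorSpaceIndex K (o a).cod)
      |>.trans_le (sum_le_of_forall_le infinite hA fun a =>
        (basis a).mk_eq_rank''.trans_le (hcod a))
    simp only [mk_sum, mk_prod, lift_id]
    exact add_le_of_le infinite hX (add_le_of_le infinite
      (mul_le_of_le infinite hX (mul_le_of_le infinite hK hK)) card_coordinates)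
  have arity_le (a) : #(ops a).Arity ≤ μ := by
    rcases a with _ | _ | p
    · exact mk_pempty.trans_le zero_le
    · exact (lt_aleph0_of_finite (ULift Bool)).le.trans hμ
    · exact (Module.Basis.ofVectorSpace K (o p.1).dom).mk_eq_rank''.trans_le (hdom p.1)
  obtain ⟨T, card_T, hT⟩ := SortedOperation.exists_preserved_sets ops hκ hμ card_ops arity_le
  have seed_mem (x : X) : seed x ∈ T x := hT (.inl x) PEmpty.elim fun b => b.elim
  obtain ⟨S, rfl⟩ := exists_submodule_eq_of_preserves (fun x => ⟨seed x, seed_mem x⟩)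
    fun x r t => hT (.inr (.inl (x, r, t)))
  exact ⟨S, seed_mem, fun a => LinearOperation.preserves_of_coordinate
    fun i => hT (.inr (.inr ⟨a, i⟩)), card_T⟩

end Closure

section ContraBasics

variable {K : Type u} [Field K]
variable {C : Type u} [AddCommGroup C] [Module K C] [Coalgebra K C]
variable {D : Type u} [AddCommGroup D] [Module K D] [Coalgebra K D]

namespace Contra

theorem isIso_iff_bijective {M N : Contra K C} (f : M ⟶ N) :
    IsIso f ↔ Function.Bijective (lin f) := by
  refine ⟨fun _ => ?_, fun hf => ?_⟩
  · exact Function.bijective_iff_has_inverse.2 ⟨lin (inv f),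
      LinearMap.congr_fun (congrArg lin (IsIso.hom_inv_id f)),
      LinearMap.congr_fun (congrArg lin (IsIso.inv_hom_id f))⟩
  · let e : M ≃ₗ[K] N := LinearEquiv.ofBijective (lin f) hf
    have lin_comp_symm : lin f ∘ₗ e.symm.toLinearMap = LinearMap.id := e.comp_symm
    let g : N ⟶ M := ⟨e.symm.toLinearMap, fun h => e.symm_apply_eq.2 <|
      ((Hom.map_contr f _).trans (by
        rw [← LinearMap.comp_assoc, lin_comp_symm, LinearMap.id_comp])).symm⟩
    exact ⟨g, Hom.ext e.symm_comp, Hom.ext e.comp_symm⟩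

section

variable {V : Type u} [AddCommGroup V] [Module K V]

/-- The linear map underlying the morphism from the free contramodule on `V` to `N` which extends
`ψ : V → N`. -/
def freeDesc (N : Contra K C) (ψ : V →ₗ[K] N) : (C →ₗ[K] V) →ₗ[K] N :=
  N.contr ∘ₗ LinearMap.llcomp K C V N ψ

theorem freeDesc_apply (N : Contra K C) (ψ : V →ₗ[K] N) (f : C →ₗ[K] V) :
    N.freeDesc ψ f = N.contr (ψ ∘ₗ f) := rfl

theorem freeDesc_counit_smulRight (N : Contra K C) (ψ : V →ₗ[K] N) (v : V) :
    N.freeDesc ψ ((Coalgebra.counit (R := K) (A := C)).smulRight v) = ψ v := by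
  rw [freeDesc_apply, ← N.contr_counit (ψ v)]
  congr 1
  ext
  simp

/-- The contraction on a space `V` which `j` embeds into `M` as a subspace closed under
contraction. -/
noncomputable def pullbackContr (M : Contra K C) (j : V →ₗ[K] M) (hj : Function.Injective j)
    (closed : ∀ f, M.freeDesc j f ∈ LinearMap.range j) : (C →ₗ[K] V) →ₗ[K] V :=
  (M.freeDesc j).codRestrictOfInjective j hj closed

theorem apply_pullbackContr (M : Contra K C) (j : V →ₗ[K] M) (hj : Function.Injective j)
    (closed : ∀ f, M.freeDesc j f ∈ LinearMap.range j) (f : C →ₗ[K] V) :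
    j (M.pullbackContr j hj closed f) = M.contr (j ∘ₗ f) :=
  LinearMap.codRestrictOfInjective_comp_apply ..

/-- The contramodule with underlying space `V` and contraction `pullbackContr`. -/
noncomputable def pullback (M : Contra K C) (j : V →ₗ[K] M) (hj : Function.Injective j)
    (closed : ∀ f, M.freeDesc j f ∈ LinearMap.range j) : Contra K C where
  carrier := V
  contr := M.pullbackContr j hj closed
  contr_counit v := hj <| (M.apply_pullbackContr j hj closed _).trans <|
    M.freeDesc_counit_smulRight j v
  contr_contr g := hj <| by
    have comp_contr : j ∘ₗ M.pullbackContr j hj closed ∘ₗ g =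
        M.contr ∘ₗ LinearMap.llcomp K C V M j ∘ₗ g :=
      LinearMap.ext fun c => M.apply_pullbackContr j hj closed (g c)
    have comp_lift : j ∘ₗ TensorProduct.lift g =
        TensorProduct.lift (LinearMap.llcomp K C V M j ∘ₗ g) := by
      ext
      rfl
    rw [apply_pullbackContr, apply_pullbackContr, comp_contr, M.contr_contr, ← comp_lift,
      LinearMap.comp_assoc]

/-- The embedding `j` as a morphism of contramodules. -/
noncomputable def pullbackHom (M : Contra K C) (j : V →ₗ[K] M) (hj : Function.Injective j)
    (closed : ∀ f, M.freeDesc j f ∈ LinearMap.range j) : M.pullback j hj closed ⟶ M where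
  toLin := j
  map_contr := M.apply_pullbackContr j hj closed

end

/-- `cohomRel` under the identification of `Hom(C, Hom(D, M))` with `Hom(C ⊗ D, M)`. -/
noncomputable def tensorRel (α : C →ₗc[K] D) (M : Contra K D) :
    (C ⊗[K] D →ₗ[K] M) →ₗ[K] (C →ₗ[K] M) :=
  cohomRel α M ∘ₗ (TensorProduct.lift.equiv (RingHom.id K) C D M).symm

theorem tensorRel_apply (α : C →ₗc[K] D) (M : Contra K D) (h : C ⊗[K] D →ₗ[K] M) :
    tensorRel α M h = h ∘ₗ rightCoact α - M.contr ∘ₗ TensorProduct.curry h :=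
  congrArg (· ∘ₗ rightCoact α - M.contr ∘ₗ TensorProduct.curry h) (TensorProduct.lift_mk_compr₂ h)

theorem range_tensorRel (α : C →ₗc[K] D) (M : Contra K D) :
    LinearMap.range (tensorRel α M) = LinearMap.range (cohomRel α M) :=
  LinearEquiv.range_comp _ _

theorem tensorRel_naturality (α : C →ₗc[K] D) {M N : Contra K D} (φ : M ⟶ N)
    (h : C ⊗[K] D →ₗ[K] M) :
    lin φ ∘ₗ tensorRel α M h = tensorRel α N (lin φ ∘ₗ h) := by
  rw [tensorRel_apply, tensorRel_apply, LinearMap.comp_sub]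
  exact congrArg _ (LinearMap.ext fun c => Hom.map_contr φ (TensorProduct.curry h c))

theorem isIso_extDesc_iff (α : C →ₗc[K] D) {M : Contra K D} {N : Contra K C}
    (φ : M ⟶ restr α N) :
    IsIso (extDesc α φ) ↔ Function.Surjective (N.freeDesc (V := M) (lin φ)) ∧
      LinearMap.ker (N.freeDesc (V := M) (lin φ)) ≤ LinearMap.range (tensorRel α M) := by
  let p : (C →ₗ[K] M) →ₗ[K] N := N.freeDesc (V := M) (lin φ)
  have hp : LinearMap.range (cohomRel α M) ≤ LinearMap.ker p := by
    rintro _ ⟨f, rfl⟩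
    have mk_eq_zero : (LinearMap.range (cohomRel α M)).mkQ (cohomRel α M f) = 0 :=
      (Submodule.Quotient.mk_eq_zero _).2 ⟨f, rfl⟩
    exact (congrArg (lin (extDesc α φ)) mk_eq_zero).trans (map_zero (lin (extDesc α φ)))
  have injective_iff : Function.Injective (Submodule.liftQ _ p hp) ↔
      LinearMap.ker p ≤ LinearMap.range (cohomRel α M) := by
    rw [← LinearMap.ker_eq_bot, Submodule.ker_liftQ, ← LinearMap.le_ker_iff_map,
      Submodule.ker_mkQ]
  have surjective_iff : Function.Surjective (Submodule.liftQ _ p hp) ↔ Function.Surjective p :=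
    (Function.Surjective.of_comp_iff _ (Submodule.mkQ_surjective _)).symm
  rw [isIso_iff_bijective, range_tensorRel, and_comm]
  exact and_congr injective_iff surjective_iff

end Contra

end ContraBasics

section TransContraBasics

variable {K : Type u} [Field K] {X : Type u} [SmallCategory X] {F : X ⥤ CoalgCat.{u} K}

namespace TransContra

/-- The underlying linear map `M_y → M_x` of a structure morphism of a trans-contramodule. -/
def mapLin (M : TransContra F) {x y : X} (α : x ⟶ y) : M.obj y →ₗ[K] M.obj x :=
  Contra.lin (M.map α)

/-- The linear map `Hom(C_x, M_y) → M_x`, `f ↦ π (mapLin α ∘ f)`, which induces the adjoint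
morphism `α^• M_y → M_x`. -/
def extend (M : TransContra F) {x y : X} (α : x ⟶ y) :
    (F.obj x →ₗ[K] M.obj y) →ₗ[K] M.obj x :=
  (M.obj x).freeDesc (M.mapLin α)

/-- The linear map `Hom(C_x ⊗ C_y, M_y) → Hom(C_x, M_y)` whose cokernel is `α^• M_y`. -/
noncomputable def rel (M : TransContra F) {x y : X} (α : x ⟶ y) :
    (F.obj x ⊗[K] F.obj y →ₗ[K] M.obj y) →ₗ[K] (F.obj x →ₗ[K] M.obj y) :=
  Contra.tensorRel (F.map α).toCoalgHom (M.obj y)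

theorem isCartesian_iff (M : TransContra F) :
    M.IsCartesian ↔ ∀ {x y : X} (α : x ⟶ y), Function.Surjective (M.extend α) ∧
      LinearMap.ker (M.extend α) ≤ LinearMap.range (M.rel α) :=
  forall₃_congr fun _ _ _ => Contra.isIso_extDesc_iff _ _

theorem extend_id (M : TransContra F) (x : X) (f : F.obj x →ₗ[K] M.obj x) :
    M.extend (𝟙 x) f = (M.obj x).contr f :=
  congrArg (M.obj x).contr (LinearMap.ext fun c => M.map_id x (f c))

theorem extend_counit_smulRight (M : TransContra F) {x y : X} (α : x ⟶ y) (m : M.obj y) :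
    M.extend α ((Coalgebra.counit (R := K) (A := F.obj x)).smulRight m) = M.mapLin α m :=
  (M.obj x).freeDesc_counit_smulRight (M.mapLin α) m

section Hom

variable {M N : TransContra F} (i : M ⟶ N)

theorem lin_app_extend {x y : X} (α : x ⟶ y) (f : F.obj x →ₗ[K] M.obj y) :
    Contra.lin (i.app x) (M.extend α f) = N.extend α (Contra.lin (i.app y) ∘ₗ f) :=
  (Contra.Hom.map_contr (i.app x) (M.mapLin α ∘ₗ f)).trans <|
    congrArg (N.obj x).contr (LinearMap.ext fun c => (i.naturality α (f c)).symm)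

theorem lin_app_comp_rel {x y : X} (α : x ⟶ y) (h : F.obj x ⊗[K] F.obj y →ₗ[K] M.obj y) :
    Contra.lin (i.app y) ∘ₗ M.rel α h = N.rel α (Contra.lin (i.app y) ∘ₗ h) :=
  Contra.tensorRel_naturality _ _ h

theorem isIso_of_bijective (hi : ∀ x, Function.Bijective (Contra.lin (i.app x))) : IsIso i := by
  have (x : X) : IsIso (i.app x) := (Contra.isIso_iff_bijective _).2 (hi x)
  let j : N ⟶ M := ⟨fun x => inv (i.app x), fun {x y} α n => (hi x).1 ?_⟩
  · exact ⟨j, Hom.ext (funext fun x => IsIso.hom_inv_id (i.app x)),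
      Hom.ext (funext fun x => IsIso.inv_hom_id (i.app x))⟩
  · have lin_lin_inv (x : X) (n : N.obj x) :
        Contra.lin (i.app x) (Contra.lin (inv (i.app x)) n) = n :=
      LinearMap.congr_fun (congrArg Contra.lin (IsIso.inv_hom_id (i.app x))) n
    exact (i.naturality α _).symm.trans <| (congrArg (N.mapLin α) (lin_lin_inv y n)).trans
      (lin_lin_inv x _).symm

end Hom

section Pullback

variable {V : X → Type u} [∀ x, AddCommGroup (V x)] [∀ x, Module K (V x)]
  (M : TransContra F) (j : ∀ x, V x →ₗ[K] M.obj x) (hj : ∀ x, Function.Injective (j x))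
  (closed : ∀ {x y : X} (α : x ⟶ y) (f : F.obj x →ₗ[K] V y),
    M.extend α (j y ∘ₗ f) ∈ LinearMap.range (j x))

include closed in
theorem freeDesc_mem_range (x : X) (f : F.obj x →ₗ[K] V x) :
    (M.obj x).freeDesc (j x) f ∈ LinearMap.range (j x) :=
  M.extend_id x (j x ∘ₗ f) ▸ closed (𝟙 x) f

include closed in
theorem mapLin_mem_range {x y : X} (α : x ⟶ y) (v : V y) :
    M.mapLin α (j y v) ∈ LinearMap.range (j x) := by
  have h := closed α ((Coalgebra.counit (R := K) (A := F.obj x)).smulRight v)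
  have comp_smulRight : j y ∘ₗ (Coalgebra.counit (R := K) (A := F.obj x)).smulRight v =
      (Coalgebra.counit (R := K) (A := F.obj x)).smulRight (j y v) := by ext; simp
  rwa [comp_smulRight, extend_counit_smulRight] at h

/-- The restriction of `mapLin` to spaces `V x` which `j` embeds into the `M_x` as subspaces closed
under the maps `extend`. -/
noncomputable def pullbackMap {x y : X} (α : x ⟶ y) : V y →ₗ[K] V x :=
  (M.mapLin α ∘ₗ j y).codRestrictOfInjective (j x) (hj x) (M.mapLin_mem_range j closed α)

theorem apply_pullbackMap {x y : X} (α : x ⟶ y) (v : V y) :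
    j x (M.pullbackMap j hj closed α v) = M.mapLin α (j y v) :=
  LinearMap.codRestrictOfInjective_comp_apply ..

theorem pullbackMap_pullbackContr {x y : X} (α : x ⟶ y) (f : F.obj y →ₗ[K] V y) :
    M.pullbackMap j hj closed α
        ((M.obj y).pullbackContr (j y) (hj y) (M.freeDesc_mem_range j closed y) f) =
      (M.obj x).pullbackContr (j x) (hj x) (M.freeDesc_mem_range j closed x)
        ((M.pullbackMap j hj closed α ∘ₗ f) ∘ₗ (F.map α).toCoalgHom.toLinearMap) := by
  apply hj x
  rw [apply_pullbackMap, Contra.apply_pullbackContr, Contra.apply_pullbackContr]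
  refine (Contra.Hom.map_contr (M.map α) (j y ∘ₗ f)).trans (congrArg (M.obj x).contr ?_)
  exact LinearMap.ext fun c => (M.apply_pullbackMap j hj closed α _).symm

theorem pullbackMap_comp {x y z : X} (α : x ⟶ y) (β : y ⟶ z) (v : V z) :
    M.pullbackMap j hj closed (α ≫ β) v =
      M.pullbackMap j hj closed α (M.pullbackMap j hj closed β v) := by
  apply hj x
  rw [apply_pullbackMap, apply_pullbackMap, apply_pullbackMap]
  exact M.map_comp α β (j z v)

/-- The trans-contramodule with underlying spaces `V x` and structure maps `pullbackMap`. -/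
noncomputable def pullback : TransContra F where
  obj x := (M.obj x).pullback (j x) (hj x) (M.freeDesc_mem_range j closed x)
  map α := ⟨M.pullbackMap j hj closed α, M.pullbackMap_pullbackContr j hj closed α⟩
  map_id x v := hj x <| (M.apply_pullbackMap j hj closed (𝟙 x) v).trans (M.map_id x (j x v))
  map_comp := M.pullbackMap_comp j hj closed

/-- The family `j` as a morphism of trans-contramodules. -/
noncomputable def pullbackHom : M.pullback j hj closed ⟶ M where
  app x := (M.obj x).pullbackHom (j x) (hj x) (M.freeDesc_mem_range j closed x)
  naturality α v := (M.apply_pullbackMap j hj closed α v).symm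

end Pullback

end TransContra

end TransContraBasics

section CartesianSubobjects

variable {K : Type u} [Field K] {X : Type u} [SmallCategory X] {F : X ⥤ CoalgCat.{u} K}

namespace TransContra

theorem IsCartesian.of_injective {P M : TransContra F} (i : P ⟶ M)
    (hi : ∀ x, Function.Injective (Contra.lin (i.app x)))
    (exists_extend_eq : ∀ {x y : X} (α : x ⟶ y) (p : P.obj x), ∃ f : F.obj x →ₗ[K] P.obj y,
      M.extend α (Contra.lin (i.app y) ∘ₗ f) = Contra.lin (i.app x) p)
    (exists_rel_eq : ∀ {x y : X} (α : x ⟶ y) (f : F.obj x →ₗ[K] P.obj y),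
      M.extend α (Contra.lin (i.app y) ∘ₗ f) = 0 → ∃ h : F.obj x ⊗[K] F.obj y →ₗ[K] P.obj y,
        M.rel α (Contra.lin (i.app y) ∘ₗ h) = Contra.lin (i.app y) ∘ₗ f) :
    P.IsCartesian := by
  refine P.isCartesian_iff.2 fun {x y} α => ⟨fun p => ?_, fun f hf => ?_⟩
  · obtain ⟨f, extend_f⟩ := exists_extend_eq α p
    exact ⟨f, hi x ((lin_app_extend i α f).trans extend_f)⟩
  · have extend_f : M.extend α (Contra.lin (i.app y) ∘ₗ f) = 0 := by
      rw [← lin_app_extend, LinearMap.mem_ker.1 hf, map_zero]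
    obtain ⟨h, rel_h⟩ := exists_rel_eq α f extend_f
    exact ⟨h, LinearMap.ext fun c => hi y <|
      LinearMap.congr_fun ((lin_app_comp_rel i α h).trans rel_h) c⟩

/-- A family of subspaces `S x` of `M_x` which is a sub-trans-contramodule (`extend_mem`), and for
which the sequence `Hom(C_x ⊗ C_y, S y) → Hom(C_x, S y) → S x → 0` is exact for all `α : x ⟶ y`. -/
structure IsCartesianSub (M : TransContra F) (S : ∀ x, Submodule K (M.obj x)) : Prop where
  extend_mem : ∀ {x y : X} (α : x ⟶ y) (f : F.obj x →ₗ[K] M.obj y), (∀ c, f c ∈ S y) →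
    M.extend α f ∈ S x
  exists_extend_eq : ∀ {x y : X} (α : x ⟶ y), ∀ m ∈ S x,
    ∃ f : F.obj x →ₗ[K] M.obj y, (∀ c, f c ∈ S y) ∧ M.extend α f = m
  exists_rel_eq : ∀ {x y : X} (α : x ⟶ y) (f : F.obj x →ₗ[K] M.obj y), (∀ c, f c ∈ S y) →
    M.extend α f = 0 →
      ∃ h : F.obj x ⊗[K] F.obj y →ₗ[K] M.obj y, (∀ t, h t ∈ S y) ∧ M.rel α h = f

namespace IsCartesianSub

variable {M : TransContra F} {S : ∀ x, Submodule K (M.obj x)} (hS : M.IsCartesianSub S)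

include hS in
theorem extend_mem_range {x y : X} (α : x ⟶ y) (f : F.obj x →ₗ[K] S y) :
    M.extend α ((S y).subtype ∘ₗ f) ∈ LinearMap.range (S x).subtype :=
  (S x).range_subtype.symm ▸ hS.extend_mem α _ fun c => (f c).2

/-- The trans-contramodule with underlying spaces `S x`. -/
noncomputable def toTransContra : TransContra F :=
  M.pullback (fun x => (S x).subtype) (fun x => (S x).injective_subtype) hS.extend_mem_range

/-- The inclusion of the sub-trans-contramodule with underlying spaces `S x`. -/
noncomputable def ι : hS.toTransContra ⟶ M :=
  M.pullbackHom (fun x => (S x).subtype) (fun x => (S x).injective_subtype) hS.extend_mem_range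

theorem isCartesian_toTransContra : hS.toTransContra.IsCartesian := by
  refine IsCartesian.of_injective hS.ι (fun x => (S x).injective_subtype) ?_ ?_
  · intro x y α (m : S x)
    obtain ⟨f, f_mem, extend_f⟩ := hS.exists_extend_eq α m m.2
    exact ⟨f.codRestrict (S y) f_mem, extend_f⟩
  · intro x y α (f : F.obj x →ₗ[K] S y) extend_f
    obtain ⟨h, h_mem, rel_h⟩ :=
      hS.exists_rel_eq α ((S y).subtype ∘ₗ f) (fun c => (f c).2) extend_f
    exact ⟨h.codRestrict (S y) h_mem, rel_h⟩

end IsCartesianSub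

variable (M : TransContra F) {x y : X} (α : x ⟶ y)

/-- `extend` as a linear operation. -/
noncomputable def extendOp : LinearOperation K fun x => M.obj x where
  dom := ModuleCat.of K (F.obj x)
  cod := ModuleCat.of K K
  src := y
  tgt := x
  eval f := LinearMap.toSpanSingleton K _ (M.extend α f)

/-- The choice of preimages under `extend` as a linear operation; elements of `M_x` are encoded as
linear maps `K → M_x`. -/
noncomputable def extendInvOp : LinearOperation K fun x => M.obj x where
  dom := ModuleCat.of K K
  cod := ModuleCat.of K (F.obj x)
  src := x
  tgt := y
  eval g := Function.invFun (M.extend α) (g 1)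

/-- The choice of preimages under `rel` as a linear operation, with junk values on the maps outside
the range of `rel`. -/
noncomputable def relInvOp : LinearOperation K fun x => M.obj x where
  dom := ModuleCat.of K (F.obj x)
  cod := ModuleCat.of K (F.obj x ⊗[K] F.obj y)
  src := y
  tgt := y
  eval f := Function.invFun (M.rel α) f

variable {M}

theorem IsCartesian.isCartesianSub (hM : M.IsCartesian) {S : ∀ x, Submodule K (M.obj x)}
    (extendOp_preserves : ∀ {x y : X} (α : x ⟶ y), (M.extendOp α).Preserves S)
    (extendInvOp_preserves : ∀ {x y : X} (α : x ⟶ y), (M.extendInvOp α).Preserves S)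
    (relInvOp_preserves : ∀ {x y : X} (α : x ⟶ y), (M.relInvOp α).Preserves S) :
    M.IsCartesianSub S where
  extend_mem α f hf := by
    have h : LinearMap.toSpanSingleton K _ (M.extend α f) (1 : K) ∈ S _ :=
      extendOp_preserves α f hf (1 : K)
    rwa [LinearMap.toSpanSingleton_apply, one_smul] at h
  exists_extend_eq {x y} α m hm := by
    have hg (r : K) : LinearMap.toSpanSingleton K (M.obj x) m r ∈ S x := (S x).smul_mem r hm
    refine ⟨_, extendInvOp_preserves α (LinearMap.toSpanSingleton K (M.obj x) m) hg, ?_⟩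
    refine (Function.invFun_eq ((M.isCartesian_iff.1 hM α).1 _)).trans ?_
    exact one_smul K m
  exists_rel_eq α f hf extend_f :=
    ⟨_, relInvOp_preserves α f hf, Function.invFun_eq ((M.isCartesian_iff.1 hM α).2 extend_f)⟩

end TransContra

section Cardinals

open Cardinal

theorem mk_le_cardMor (X : Type u) [SmallCategory X] : #X ≤ cardMor X :=
  mk_le_of_injective (f := fun x => (⟨(x, x), 𝟙 x⟩ : Σ p : X × X, p.1 ⟶ p.2)) fun _ _ h =>
    congrArg (fun p => p.1.1) h

variable (F)

theorem aleph0_le_mu : ℵ₀ ≤ mu F := le_max_left _ _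

theorem rank_le_mu (x : X) : Module.rank K (F.obj x) ≤ mu F :=
  (le_ciSup (bddAbove_of_small) x).trans (le_max_right _ _)

theorem rank_self_le_mu : Module.rank K K ≤ mu F :=
  (Module.rank_self K).trans_le (one_le_aleph0.trans (aleph0_le_mu F))

theorem rank_tensorProduct_le_mu (x y : X) : Module.rank K (F.obj x ⊗[K] F.obj y) ≤ mu F := by
  rw [rank_tensorProduct']
  exact mul_le_of_le (aleph0_le_mu F) (rank_le_mu F x) (rank_le_mu F y)

end Cardinals

end CartesianSubobjects

section Existence

open Cardinal

variable {K : Type u} [Field K] {X : Type u} [SmallCategory X] {F : X ⥤ CoalgCat.{u} K}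

namespace TransContra

/-- The operations `extendOp`, `extendInvOp` and `relInvOp` for all morphisms of `X`. -/
noncomputable def cartesianOps (M : TransContra F) :
    (Σ p : X × X, p.1 ⟶ p.2) ⊕ (Σ p : X × X, p.1 ⟶ p.2) ⊕ (Σ p : X × X, p.1 ⟶ p.2) →
      LinearOperation K fun x => M.obj x :=
  Sum.elim (fun α => M.extendOp α.2) <|
    Sum.elim (fun α => M.extendInvOp α.2) fun α => M.relInvOp α.2

theorem rank_dom_cartesianOps_le (M : TransContra F) (a) :
    Module.rank K (M.cartesianOps a).dom ≤ mu F := by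
  rcases a with _ | _ | _
  · exact rank_le_mu F _
  · exact rank_self_le_mu F
  · exact rank_le_mu F _

theorem rank_cod_cartesianOps_le (M : TransContra F) (a) :
    Module.rank K (M.cartesianOps a).cod ≤ mu F := by
  rcases a with _ | _ | _
  · exact rank_self_le_mu F
  · exact rank_le_mu F _
  · exact rank_tensorProduct_le_mu F _ _

theorem IsCartesian.exists_isCartesianSub {M : TransContra F} (hM : M.IsCartesian) {x : X}
    (m : M.obj x) :
    ∃ S : ∀ y, Submodule K (M.obj y), M.IsCartesianSub S ∧ m ∈ S x ∧
      #(Σ y, S y) ≤ max #K (cardMor X) ^ mu F := by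
  classical
  set κ := max #K (cardMor X)
  have one_lt : 1 < κ := (one_lt_iff_nontrivial.2 inferInstance).trans_le (le_max_left _ _)
  have mu_le : mu F ≤ κ ^ mu F := (cantor' _ one_lt).le
  have le_power : κ ≤ κ ^ mu F := self_le_power _ (one_le_aleph0.trans (aleph0_le_mu F))
  have infinite : ℵ₀ ≤ κ ^ mu F := (aleph0_le_mu F).trans mu_le
  have cardMor_le : cardMor X ≤ κ ^ mu F := (le_max_right _ _).trans le_power
  have ops_le := add_le_of_le infinite cardMor_le (add_le_of_le infinite cardMor_le cardMor_le)
  obtain ⟨S, seed_mem, preserves, card_S⟩ :=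
    LinearOperation.exists_preserved_submodules M.cartesianOps (Pi.single x m) one_lt
      (aleph0_le_mu F) ((le_max_left _ _).trans le_power) ((mk_le_cardMor X).trans cardMor_le)
      (by simpa only [mk_sum, lift_id, cardMor] using ops_le) M.rank_dom_cartesianOps_le
      fun a => (M.rank_cod_cartesianOps_le a).trans mu_le
  refine ⟨S, ?_, ?_, card_S⟩
  · exact hM.isCartesianSub (fun {y z} α => preserves (.inl ⟨(y, z), α⟩))
      (fun {y z} α => preserves (.inr (.inl ⟨(y, z), α⟩)))
      fun {y z} α => preserves (.inr (.inr ⟨(y, z), α⟩))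
  · simpa only [Pi.single_eq_same] using seed_mem x

end TransContra

theorem CartTransContra.exists_subobject_card_le (M : CartTransContra F) (x : X) (m : M.obj.obj x) :
    ∃ (P : CartTransContra F) (i : P ⟶ M),
      (∀ y : X, Function.Injective (Contra.lin (i.hom.app y))) ∧
      m ∈ Set.range (Contra.lin (i.hom.app x)) ∧
      P.obj.card ≤ max #K (cardMor X) ^ mu F := by
  obtain ⟨S, hS, mem, card_S⟩ := TransContra.IsCartesian.exists_isCartesianSub M.property m
  exact ⟨⟨hS.toTransContra, hS.isCartesian_toTransContra⟩, ObjectProperty.homMk hS.ι,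
    fun y => (S y).injective_subtype, ⟨(⟨m, mem⟩ : S x), rfl⟩, card_S⟩

end Existence

section EssentiallySmall

universe v w

variable {C : Type w} [Category.{v} C]

theorem exists_ofObj_isSeparating {P : ObjectProperty C} [ObjectProperty.EssentiallySmall.{u} P]
    (hP : P.IsSeparating) :
    ∃ (ι : Type u) (G : ι → C), (ObjectProperty.ofObj G).IsSeparating := by
  obtain ⟨Q, small, P_le⟩ := ObjectProperty.EssentiallySmall.exists_small_le'.{u} P
  have : Small.{u} (Subtype Q) := small
  refine ⟨Shrink.{u} (Subtype Q), fun a => ((equivShrink _).symm a).1, fun M N f g hfg => ?_⟩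
  refine hP f g fun A hA h => ?_
  obtain ⟨B, hB, ⟨e⟩⟩ := P_le A hA
  have B_mem : ObjectProperty.ofObj (fun a => ((equivShrink (Subtype Q)).symm a).1) B := by
    simpa only [Equiv.symm_apply_apply] using ObjectProperty.ofObj_apply
      (fun a => ((equivShrink (Subtype Q)).symm a).1) (equivShrink _ ⟨B, hB⟩)
  simpa only [Category.assoc, Iso.hom_inv_id_assoc] using
    congrArg (e.hom ≫ ·) (hfg B B_mem (e.inv ≫ h))

instance essentiallySmall_inverseImage_ι (P Q : ObjectProperty C)
    [ObjectProperty.EssentiallySmall.{u} P] :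
    ObjectProperty.EssentiallySmall.{u} (P.inverseImage Q.ι) where
  exists_small_le' := by
    have : ObjectProperty.EssentiallySmall.{u} (P ⊓ Q) := .of_le inf_le_left
    obtain ⟨R, small, R_le, le_isoClosure⟩ :=
      ObjectProperty.EssentiallySmall.exists_small_le.{u} (P ⊓ Q)
    have : Small.{u} (Subtype R) := small
    let G (A : Subtype R) : Q.FullSubcategory := ⟨A.1, (R_le _ A.2).2⟩
    refine ⟨ObjectProperty.ofObj G, inferInstance, fun A hA => ?_⟩
    obtain ⟨B, hB, ⟨e⟩⟩ := le_isoClosure A.obj ⟨hA, A.property⟩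
    exact ⟨G ⟨B, hB⟩, ⟨_⟩, ⟨Q.isoMk e⟩⟩

end EssentiallySmall

section SmallGenerators

variable {K : Type u} [Field K]

theorem Contra.small_carrier_eq {C : Type u} [AddCommGroup C] [Module K C] [Coalgebra K C]
    (V : Type u) : ObjectProperty.Small.{u} fun M : Contra K C => M.carrier = V := by
  let ofStructure (s : Σ (_ : AddCommGroup V) (_ : Module K V),
      {π : (C →ₗ[K] V) →ₗ[K] V //
        (∀ m, π ((Coalgebra.counit (R := K) (A := C)).smulRight m) = m) ∧
        ∀ g : C →ₗ[K] (C →ₗ[K] V),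
          π (π ∘ₗ g) = π (TensorProduct.lift g ∘ₗ Coalgebra.comul)}) :
      Subtype fun M : Contra K C => M.carrier = V :=
    letI := s.1
    letI := s.2.1
    ⟨⟨V, s.2.2.1, s.2.2.2.1, s.2.2.2.2⟩, rfl⟩
  refine small_of_surjective (f := ofStructure) ?_
  rintro ⟨M, rfl⟩
  exact ⟨⟨M.addCommGroup, M.module, M.contr, M.contr_counit, M.contr_contr⟩, rfl⟩

variable {X : Type u} [SmallCategory X] {F : X ⥤ CoalgCat.{u} K}

namespace TransContra

theorem small_carrier_eq (V : X → Type u) :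
    ObjectProperty.Small.{u} fun M : TransContra F => ∀ x, (M.obj x).carrier = V x := by
  have (x : X) := Contra.small_carrier_eq (K := K) (C := F.obj x) (V x)
  let ofStructure (s : Σ (N : ∀ x, Subtype fun N : Contra K (F.obj x) => N.carrier = V x),
      {φ : ∀ α : Σ p : X × X, p.1 ⟶ p.2,
          (N α.1.2).1 ⟶ Contra.restr (F.map α.2).toCoalgHom (N α.1.1).1 //
        (∀ (x : X) (m : (N x).1), Contra.lin (φ ⟨(x, x), 𝟙 x⟩) m = m) ∧
        ∀ {x y z : X} (α : x ⟶ y) (β : y ⟶ z) (m : (N z).1),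
          Contra.lin (φ ⟨(x, z), α ≫ β⟩) m =
            Contra.lin (φ ⟨(x, y), α⟩) (Contra.lin (φ ⟨(y, z), β⟩) m)}) :
      Subtype fun M : TransContra F => ∀ x, (M.obj x).carrier = V x :=
    ⟨⟨fun x => (s.1 x).1, fun {x y} α => s.2.1 ⟨(x, y), α⟩, s.2.2.1, s.2.2.2⟩, fun x => (s.1 x).2⟩
  refine small_of_surjective (f := ofStructure) ?_
  rintro ⟨M, hM⟩
  exact ⟨⟨fun x => ⟨M.obj x, hM x⟩, fun α => M.map α.2, M.map_id, M.map_comp⟩, rfl⟩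

theorem exists_iso_carrier_eq (M : TransContra F) {V : X → Type u} (e : ∀ x, V x ≃ M.obj x) :
    ∃ N : TransContra F, (∀ x, (N.obj x).carrier = V x) ∧ Nonempty (N ≅ M) := by
  let _ (x : X) : AddCommGroup (V x) := (e x).addCommGroup
  let _ (x : X) : Module K (V x) := (e x).module K
  let j (x : X) : V x →ₗ[K] M.obj x := ((e x).linearEquiv K).toLinearMap
  have hj (x : X) : Function.Bijective (j x) := (e x).bijective
  have closed {x y : X} (α : x ⟶ y) (f : F.obj x →ₗ[K] V y) :
      M.extend α (j y ∘ₗ f) ∈ LinearMap.range (j x) := (hj x).2 _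
  have := isIso_of_bijective (M.pullbackHom j (fun x => (hj x).1) closed) hj
  exact ⟨M.pullback j (fun x => (hj x).1) closed, fun _ => rfl,
    ⟨asIso (M.pullbackHom j (fun x => (hj x).1) closed)⟩⟩

open Cardinal in
theorem essentiallySmall_card_le (c : Cardinal.{u}) :
    ObjectProperty.EssentiallySmall.{u} fun M : TransContra F => M.card ≤ c where
  exists_small_le' := by
    have (a : X → Set.Iic c) : ObjectProperty.Small.{u} fun M : TransContra F =>
      ∀ x, (M.obj x).carrier = (a x).1.out := small_carrier_eq _
    refine ⟨⨆ (a : X → Set.Iic c), fun M => ∀ x, (M.obj x).carrier = (a x).1.out, inferInstance,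
      fun M card_M => ?_⟩
    have component_le (x : X) : #(M.obj x) ≤ c :=
      (mk_le_of_injective (sigma_mk_injective (i := x))).trans card_M
    obtain ⟨N, hN, ⟨e⟩⟩ := M.exists_iso_carrier_eq fun x => outMkEquiv (α := M.obj x)
    exact ⟨N, (ObjectProperty.prop_iSup_iff _ _).2 ⟨fun x => ⟨_, component_le x⟩, hN⟩, ⟨e.symm⟩⟩

end TransContra

theorem CartTransContra.exists_isSeparating_of_subobjects {c : Cardinal.{u}}
    (exists_subobject : ∀ (M : CartTransContra F) (x : X) (m : M.obj.obj x),
      ∃ (P : CartTransContra F) (i : P ⟶ M), m ∈ Set.range (Contra.lin (i.hom.app x)) ∧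
        P.obj.card ≤ c) :
    ∃ (ι : Type u) (G : ι → CartTransContra F), (ObjectProperty.ofObj G).IsSeparating := by
  let cardLE : ObjectProperty (TransContra F) := fun M => M.card ≤ c
  have : ObjectProperty.EssentiallySmall.{u} cardLE := TransContra.essentiallySmall_card_le c
  refine exists_ofObj_isSeparating (P := cardLE.inverseImage (ObjectProperty.ι _))
    fun M N f g h => ?_
  refine ObjectProperty.hom_ext _ (TransContra.Hom.ext (funext fun x => ?_))
  refine Contra.Hom.ext (LinearMap.ext fun m => ?_)
  obtain ⟨P, i, ⟨p, rfl⟩, card_P⟩ := exists_subobject M x m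
  exact LinearMap.congr_fun
    (congrArg (fun φ : P ⟶ N => Contra.lin (φ.hom.app x)) (h P card_P i)) p

end SmallGenerators

theorem max_mk_cardMor_le_kappa {K : Type u} [Field K] {X : Type u} [SmallCategory X]
    (F : X ⥤ CoalgCat.{u} K) (lam : Cardinal.{u}) :
    max (Cardinal.mk K) (cardMor X) ≤ kappa F lam :=
  (max_le_max (le_max_right _ _) (le_max_right _ _)).trans (le_max_left _ _)

theorem mainTheorem9_general {K : Type u} [Field K] {X : Type u} [SmallCategory X]
    (F : X ⥤ CoalgCat.{u} K) :
    (∃ (ι : Type u) (G : ι → CartTransContra F), (ObjectProperty.ofObj G).IsSeparating) ∧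
    ∀ (M : CartTransContra F) (x : X) (m : M.obj.obj x),
      ∃ (P : CartTransContra F) (i : P ⟶ M),
        (∀ y : X, Function.Injective (Contra.lin (i.hom.app y))) ∧
        m ∈ Set.range (Contra.lin (i.hom.app x)) ∧
        P.obj.card ≤ max (Cardinal.mk K) (cardMor X) ^ mu F := by
  have exists_subobject := CartTransContra.exists_subobject_card_le (F := F)
  refine ⟨CartTransContra.exists_isSeparating_of_subobjects
    (c := max (Cardinal.mk K) (cardMor X) ^ mu F) fun M x m => ?_, exists_subobject⟩
  obtain ⟨P, i, -, mem_range, card_P⟩ := exists_subobject M x m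
  exact ⟨P, i, mem_range, card_P⟩

theorem mainTheorem9 {K : Type u} [Field K] {X : Type u} [PartialOrder X]
    (F : X ⥤ CoalgCat.{u} K) (hF : RightCoflatRep F) :
    (∃ (ι : Type u) (G : ι → CartTransContra F), (ObjectProperty.ofObj G).IsSeparating) ∧
    (∀ (lam : Cardinal.{u}) [Fact lam.IsRegular],
      (∀ x : X, IsCardinalPresentable (Contra.dual K (F.obj x)) lam) →
      ∀ (M : CartTransContra F) (x : X) (m : M.obj.obj x),
        ∃ (P : CartTransContra F) (i : P ⟶ M),
          (∀ y : X, Function.Injective (Contra.lin (i.hom.app y))) ∧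
          m ∈ Set.range (Contra.lin (i.hom.app x)) ∧
          P.obj.card ≤ kappa F lam ^ mu F) := by
  refine ⟨(mainTheorem9_general F).1, fun lam _ _ M x m => ?_⟩
  obtain ⟨P, i, injective, mem_range, card_P⟩ := (mainTheorem9_general F).2 M x m
  exact ⟨P, i, injective, mem_range,
    card_P.trans (Cardinal.power_le_power_right (max_mk_cardMor_le_kappa F lam))⟩
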